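/- Let $n\ge 0$ and let $f:\mathbb{C}^n\to\mathbb{C}$ be a mixed polynomial, i.e. $f(\mathbf z)=P(\mathbf z,\bar{\mathbf z})$ for a complex polynomial $P$ in the variables $z_1,\dots,z_n,\bar z_1,\dots,\bar z_n$, and let $\partial f/\partial z_k$, $\partial f/\partial\bar z_k$ be its partial derivatives with respect to these variables. Let $\operatorname{Sing} f$ be the set of points of $\mathbb{C}^n=\mathbb{R}^{2n}$ at which the real differential of $f:\mathbb{R}^{2n}\to\mathbb{R}^2$ is not surjective. Let $$M(f)=\Bigl\{\mathbf z\in\mathbb{C}^n \;\Big|\; \exists\,\lambda\in\mathbb{R},\ \mu\in\mathbb{C}\setminus\{0\}:\ \lambda z_k=\mu\,\overline{\frac{\partial f}{\partial z_k}(\mathbf z)}+\bar\mu\,\frac{\partial f}{\partial\bar z_k}(\mathbf z)\ \text{ for } k=1,\dots,n\Bigr\}$$ and let $S(f)$ be the set of all $c\in\mathbb{C}$ for which there is a sequence $(\mathbf z_j)_{j\in\mathbb{N}}$ in $M(f)$ with $\lim_{j\to\infty}\|\mathbf z_j\|=\infty$ and $\lim_{j\to\infty} f(\mathbf z_j)=c$.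 Then $S(f)$ and $f(\operatorname{Sing} f)\cup S(f)$ are closed semialgebraic subsets of $\mathbb{C}=\mathbb{R}^2$, where the semialgebraic subsets of $\mathbb{R}^m$ are the members of the smallest family of subsets that contains all sets $\{x\in\mathbb{R}^m\mid p(x)>0\}$ with $p\in\mathbb{R}[x_1,\dots,x_m]$ and is stable under finite unions, finite intersections and complements. -/

import Mathlib

open Filter Topology

/-- Semialgebraic subsets of `ℝᵐ`: the smallest family of subsets that contains the sets
`{x | p x > 0}`, `p` a real polynomial, and is stable under finite unions, finite intersections
and complements. -/
inductive IsSemialgebraic {m : ℕ} : Set (Fin m → ℝ) → Prop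
  | pos (p : MvPolynomial (Fin m) ℝ) : IsSemialgebraic {x | 0 < MvPolynomial.eval x p}
  | union {A B : Set (Fin m → ℝ)} :
      IsSemialgebraic A → IsSemialgebraic B → IsSemialgebraic (A ∪ B)
  | inter {A B : Set (Fin m → ℝ)} :
      IsSemialgebraic A → IsSemialgebraic B → IsSemialgebraic (A ∩ B)
  | compl {A : Set (Fin m → ℝ)} : IsSemialgebraic A → IsSemialgebraic Aᶜ

/-- A subset of `ℂ` is semialgebraic if it is so under the identification
`(x, y) ↦ x + i y` of `ℝ²` with `ℂ`. -/
def IsSemialgebraicComplex (A : Set ℂ) : Prop :=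
  IsSemialgebraic {x : Fin 2 → ℝ | (⟨x 0, x 1⟩ : ℂ) ∈ A}

/-- Mixed polynomials in `n` complex variables: complex polynomials in `z₁, …, zₙ`
(the variables `Sum.inl k`) and `z̄₁, …, z̄ₙ` (the variables `Sum.inr k`). -/
abbrev MixedPolynomial (n : ℕ) : Type := MvPolynomial (Fin n ⊕ Fin n) ℂ

namespace MixedPolynomial

variable {n : ℕ}

/-- The value `p(z, z̄)`. -/
noncomputable def toFun (p : MixedPolynomial n) (z : EuclideanSpace ℂ (Fin n)) : ℂ :=
  MvPolynomial.eval (Sum.elim (fun k => z k) (fun k => star (z k))) p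

/-- The function `∂f/∂z_k`. -/
noncomputable def dz (f : MixedPolynomial n) (k : Fin n) (z : EuclideanSpace ℂ (Fin n)) : ℂ :=
  toFun (MvPolynomial.pderiv (Sum.inl k) f) z

/-- The function `∂f/∂z̄_k`. -/
noncomputable def dzbar (f : MixedPolynomial n) (k : Fin n) (z : EuclideanSpace ℂ (Fin n)) : ℂ :=
  toFun (MvPolynomial.pderiv (Sum.inr k) f) z

/-- The singular locus: the critical points of `f` as a real map `ℝ²ⁿ → ℝ²`, that is, the points
where the real differential of `f` is not surjective. -/
def singularLocus (f : MixedPolynomial n) : Set (EuclideanSpace ℂ (Fin n)) :=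
  {z | ¬ Function.Surjective (fderiv ℝ (toFun f) z)}

/-- The Milnor set `M(f)`: the points `z` for which there are `λ ∈ ℝ` and `μ ∈ ℂ ∖ {0}` such that
`λ z_k = μ * conj (∂f/∂z_k) + conj μ * ∂f/∂z̄_k` for every `k`. -/
def milnorSet (f : MixedPolynomial n) : Set (EuclideanSpace ℂ (Fin n)) :=
  {z | ∃ (l : ℝ) (μ : ℂ), μ ≠ 0 ∧
    ∀ k : Fin n, (l : ℂ) * z k = μ * star (dz f k z) + star μ * dzbar f k z}

/-- The set `S(f)` of asymptotic `ρ`-nonregular values of `f`. -/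
def asymptoticValues (f : MixedPolynomial n) : Set ℂ :=
  {c | ∃ z : ℕ → EuclideanSpace ℂ (Fin n), (∀ j, z j ∈ milnorSet f) ∧
    Tendsto (fun j => ‖z j‖) atTop atTop ∧ Tendsto (fun j => toFun f (z j)) atTop (𝓝 c)}

end MixedPolynomial

/-! ### Sign conditions on specialised univariate polynomials -/

/-! Closedness. A value lies in `S(f)` iff, for every `r`, it is in the closure of the image of
`M(f) ∩ {‖z‖ > r}`; so `S(f)` is an intersection of closures. A limit of critical values either
comes from critical points in a fixed ball, and is then a critical value by compactness, or it comes
from critical points tending to infinity. These lie in `M(f)` (take `λ = 0`), so the limit is in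
`S(f)`.

Semialgebraicity. Both sets are described by quantifiers over reals applied to polynomial
conditions, so it suffices to eliminate quantifiers (Tarski–Seidenberg). Instead of formulas, the
argument uses sets for which membership depends only on the signs of finitely many polynomials. To
eliminate one variable `t`, enlarge the given polynomials in `t` to a finite family closed under
derivation, removal of the leading term and pseudo-remainders. The signs of its coefficients at a
parameter determine which sign vectors are realised on the line (`exists_signEq`).

That is proved by adding polynomials in order of degree. Where the lower-degree ones have no root,
the derivative keeps a strict sign, so the new polynomial is monotone between consecutive roots; at
a root, a remainder gives its sign. Thom's lemma makes the sign classes intervals and fixes their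
order, so the pictures over two parameters match. -/

section SignConditions

open Polynomial

variable {A : Type*} [CommRing A]

/-- The polynomials in `F`, specialised along `a` at `x` and along `b` at `y`, have the same
signs. -/
def SignEq (F : Set A[X]) (a b : A →+* ℝ) (x y : ℝ) : Prop :=
  ∀ q ∈ F, SignType.sign ((q.map a).eval x) = SignType.sign ((q.map b).eval y)

theorem SignEq.symm {F : Set A[X]} {a b : A →+* ℝ} {x y : ℝ} (h : SignEq F a b x y) :
    SignEq F b a y x := fun q hq => (h q hq).symm

/-- A set of polynomials containing the derivatives of its nonconstant elements. -/
def DerivClosed (F : Set A[X]) : Prop :=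
  ∀ p ∈ F, p.natDegree ≠ 0 → derivative p ∈ F

theorem Polynomial.eval_le_eval_of_derivative_nonneg {p : ℝ[X]} {u v : ℝ} (huv : u ≤ v)
    (h : ∀ t ∈ Set.Icc u v, 0 ≤ p.derivative.eval t) : p.eval u ≤ p.eval v := by
  refine monotoneOn_of_deriv_nonneg (convex_Icc u v) p.continuousOn
    p.differentiable.differentiableOn (fun t ht => ?_) (Set.left_mem_Icc.2 huv)
    (Set.right_mem_Icc.2 huv) huv
  rw [Polynomial.deriv]
  exact h t (interior_subset ht)

theorem Polynomial.eval_le_eval_of_derivative_nonpos {p : ℝ[X]} {u v : ℝ} (huv : u ≤ v)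
    (h : ∀ t ∈ Set.Icc u v, p.derivative.eval t ≤ 0) : p.eval v ≤ p.eval u := by
  have := Polynomial.eval_le_eval_of_derivative_nonneg (p := -p) huv
    (fun t ht => by simpa using h t ht)
  simpa using this

theorem Polynomial.eval_lt_eval_of_derivative_pos {p : ℝ[X]} {u v : ℝ} (huv : u < v)
    (h : ∀ t ∈ Set.Ioo u v, 0 < p.derivative.eval t) : p.eval u < p.eval v := by
  refine strictMonoOn_of_deriv_pos (convex_Icc u v) p.continuousOn (fun t ht => ?_)
    (Set.left_mem_Icc.2 huv.le) (Set.right_mem_Icc.2 huv.le) huv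
  rw [Polynomial.deriv]
  exact h t (by simpa using ht)

/-- Thom's lemma: the sign conditions on a family closed under derivation define convex sets. -/
theorem SignEq.of_mem_Icc {F : Set A[X]} (hF : DerivClosed F) {a : A →+* ℝ} {x x' : ℝ}
    (h : SignEq F a a x x') {z : ℝ} (hz : z ∈ Set.Icc x x') : SignEq F a a x z := by
  suffices H : ∀ n : ℕ, ∀ p ∈ F, p.natDegree = n → ∀ z ∈ Set.Icc x x',
      SignType.sign ((p.map a).eval x) = SignType.sign ((p.map a).eval z) from
    fun q hq => H _ q hq rfl z hz
  intro n
  induction n using Nat.strong_induction_on with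
  | _ n ih =>
    rintro p hp rfl z hz
    by_cases hd : p.natDegree = 0
    · rw [natDegree_eq_zero] at hd
      obtain ⟨c, rfl⟩ := hd
      simp
    -- By induction the derivative has constant sign on the interval, so `p` is monotone there and
    -- its equal signs at the ends force the sign between.
    · have key := ih _ (natDegree_derivative_lt hd) _ (hF p hp hd) rfl
      rw [← derivative_map] at key
      have hx := h p hp
      rcases le_total 0 ((p.map a).derivative.eval x) with h0 | h0
      · have hpos : ∀ t ∈ Set.Icc x x', 0 ≤ (p.map a).derivative.eval t := fun t ht => by
          rw [← sign_nonneg_iff, ← key t ht]; exact sign_nonneg_iff.2 h0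
        have h1 := eval_le_eval_of_derivative_nonneg hz.1
          (fun t ht => hpos t ⟨ht.1, ht.2.trans hz.2⟩)
        have h2 := eval_le_eval_of_derivative_nonneg hz.2
          (fun t ht => hpos t ⟨hz.1.trans ht.1, ht.2⟩)
        exact le_antisymm (SignType.sign.monotone h1)
          ((SignType.sign.monotone h2).trans hx.symm.le)
      · have hneg : ∀ t ∈ Set.Icc x x', (p.map a).derivative.eval t ≤ 0 := fun t ht => by
          rw [← sign_nonpos_iff, ← key t ht]; exact sign_nonpos_iff.2 h0
        have h1 := eval_le_eval_of_derivative_nonpos hz.1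
          (fun t ht => hneg t ⟨ht.1, ht.2.trans hz.2⟩)
        have h2 := eval_le_eval_of_derivative_nonpos hz.2
          (fun t ht => hneg t ⟨hz.1.trans ht.1, ht.2⟩)
        exact le_antisymm (hx.le.trans (SignType.sign.monotone h2))
          (SignType.sign.monotone h1)

/-- The order of two points with different sign vectors is determined by the sign vectors. -/
theorem SignEq.lt_of_lt {F : Set A[X]} (hF : DerivClosed F) {a b : A →+* ℝ} {x x' y y' : ℝ}
    (h : SignEq F a b x y) (h' : SignEq F a b x' y') (hne : ¬ SignEq F a a x x') (hlt : x < x') :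
    y < y' := by
  classical
  -- Take a separating `p` of least degree. All lower-degree signs agree at the four points, so if
  -- `y' ≤ y`, then `p` is monotone in the same direction on `[x, x']` and `[y', y]`; the two
  -- comparisons then force equal signs.
  have hex : ∃ n : ℕ, ∃ p ∈ F, p.natDegree = n ∧
      SignType.sign ((p.map a).eval x) ≠ SignType.sign ((p.map a).eval x') := by
    simp only [SignEq, not_forall] at hne
    obtain ⟨p, hp, hpne⟩ := hne
    exact ⟨_, p, hp, rfl, hpne⟩
  obtain ⟨p, hp, hpd, hpne⟩ := Nat.find_spec hex
  have hmin : ∀ q ∈ F, q.natDegree < p.natDegree →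
      SignType.sign ((q.map a).eval x) = SignType.sign ((q.map a).eval x') := fun q hq hlt => by
    by_contra hcon
    exact Nat.find_min hex (hpd ▸ hlt) ⟨q, hq, rfl, hcon⟩
  have hd : p.natDegree ≠ 0 := fun hd => hpne <| by
    rw [natDegree_eq_zero] at hd
    obtain ⟨c, rfl⟩ := hd
    simp
  set G : Set A[X] := {q | q ∈ F ∧ q.natDegree < p.natDegree} with hG
  have hGF : G ⊆ F := fun q hq => hq.1
  have hGd : DerivClosed G := fun q hq hq0 =>
    ⟨hF q hq.1 hq0, (natDegree_derivative_lt hq0).trans hq.2⟩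
  have hpG : derivative p ∈ G := ⟨hF p hp hd, natDegree_derivative_lt hd⟩
  have hGx : SignEq G a a x x' := fun q hq => hmin q hq.1 hq.2
  have hGy : SignEq G b b y' y := fun q hq =>
    (h' q hq.1).symm.trans ((hGx q hq).symm.trans (h q hq.1))
  have hxc : ∀ t ∈ Set.Icc x x', SignType.sign ((p.map a).derivative.eval x) =
      SignType.sign ((p.map a).derivative.eval t) := fun t ht => by
    simpa only [derivative_map] using hGx.of_mem_Icc hGd ht _ hpG
  have hyc : ∀ t ∈ Set.Icc y' y, SignType.sign ((p.map a).derivative.eval x) =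
      SignType.sign ((p.map b).derivative.eval t) := fun t ht => by
    have h1 := hGy.of_mem_Icc hGd ht _ hpG
    rw [← h' _ hpG.1, ← hGx _ hpG] at h1
    simpa only [derivative_map] using h1
  by_contra hyy
  rw [not_lt] at hyy
  refine hpne ?_
  have e1 := h p hp
  have e2 := h' p hp
  rcases le_total 0 ((p.map a).derivative.eval x) with h0 | h0
  · have h1 := SignType.sign.monotone <| eval_le_eval_of_derivative_nonneg hlt.le
      (fun t ht => by rw [← sign_nonneg_iff, ← hxc t ht]; exact sign_nonneg_iff.2 h0)
    have h2 := SignType.sign.monotone <| eval_le_eval_of_derivative_nonneg hyy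
      (fun t ht => by rw [← sign_nonneg_iff, ← hyc t ht]; exact sign_nonneg_iff.2 h0)
    exact le_antisymm h1 (e2.le.trans (h2.trans e1.ge))
  · have h1 := SignType.sign.monotone <| eval_le_eval_of_derivative_nonpos hlt.le
      (fun t ht => by rw [← sign_nonpos_iff, ← hxc t ht]; exact sign_nonpos_iff.2 h0)
    have h2 := SignType.sign.monotone <| eval_le_eval_of_derivative_nonpos hyy
      (fun t ht => by rw [← sign_nonpos_iff, ← hyc t ht]; exact sign_nonpos_iff.2 h0)
    exact le_antisymm (e1.le.trans (h2.trans e2.ge)) h1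

/-- A nonconstant real polynomial which is increasing on a left half-line takes negative values
there. -/
theorem Polynomial.exists_eval_neg_of_derivative_pos {Q : ℝ[X]} (hQ : Q.natDegree ≠ 0) (y : ℝ)
    (h : ∀ t ≤ y, 0 < Q.derivative.eval t) : ∃ t ≤ y, Q.eval t < 0 := by
  by_contra! hcon
  have hdeg : 0 < (Q.comp (-X)).degree := by
    rw [← natDegree_pos_iff_degree_pos, natDegree_comp]
    simpa [Nat.pos_iff_ne_zero] using hQ
  have ht := Polynomial.abs_tendsto_atTop (Q.comp (-X)) hdeg
  obtain ⟨t, ht1, ht2⟩ := ((ht.eventually_gt_atTop (Q.eval y)).and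
    (eventually_ge_atTop (-y))).exists
  have hty : -t ≤ y := by linarith
  have := eval_le_eval_of_derivative_nonneg hty (fun s hs => (h s hs.2).le)
  simp only [eval_comp, eval_neg, eval_X] at ht1
  rw [abs_of_nonneg (hcon _ hty)] at ht1
  linarith

/-- Let `G` and `H` be two maps on the line with the same values in the same order. If `P` and `Q`
increase on the fibres of `G` and `H` over `v`, have the same signs at the boundary of the fibres,
and `P` is somewhere nonpositive on the first fibre, then `Q` is somewhere negative on the
second one. -/
theorem exists_eval_neg_of_fibre {V : Type*} {G H : ℝ → V} {P Q : ℝ[X]} {v : V} {x : ℝ}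
    (hG : ∀ x, ∃ y, G x = H y) (hH : ∀ y, ∃ x, G x = H y)
    (hord : ∀ x x' y y', G x = H y → G x' = H y' → G x ≠ G x' → x < x' → y < y')
    (hopen : IsOpen {y | H y = v}) (hconn : Set.OrdConnected {y | H y = v})
    (hP : ∀ t, G t = v → 0 < P.derivative.eval t) (hQ : ∀ t, H t = v → 0 < Q.derivative.eval t)
    (hQ0 : Q.natDegree ≠ 0)
    (hbd : ∀ x y, G x = H y → H y ≠ v → y ∈ closure {y | H y = v} →
      SignType.sign (P.eval x) = SignType.sign (Q.eval y) ∧ ∀ x', G x' = G x → x' = x)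
    (hx : G x = v) (hPx : P.eval x ≤ 0) : ∃ y, H y = v ∧ Q.eval y < 0 := by
  by_contra! hcon
  obtain ⟨y, hy⟩ := hG x
  have hyJ : y ∈ {y | H y = v} := hy.symm.trans hx
  -- Otherwise the fibre contains a left half-line, on which the increasing nonconstant `Q` becomes
  -- negative.
  have hbdd : BddBelow {y | H y = v} := by
    by_contra hnb
    rw [not_bddBelow_iff] at hnb
    have hsub : ∀ t ≤ y, H t = v := fun t ht => by
      obtain ⟨u, hu, hut⟩ := hnb t
      exact hconn.out hu hyJ ⟨hut.le, ht⟩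
    obtain ⟨t, ht, htn⟩ := exists_eval_neg_of_derivative_pos hQ0 y (fun t ht => hQ t (hsub t ht))
    exact absurd (hcon t (hsub t ht)) (not_le.2 htn)
  have hcl := csInf_mem_closure ⟨y, hyJ⟩ hbdd
  set y₀ := sInf {y | H y = v} with hy₀
  have hle : ∀ z, H z = v → y₀ ≤ z := fun z hz => csInf_le hbdd hz
  have hy₀v : H y₀ ≠ v := fun hv => by
    obtain ⟨ε, hε, hball⟩ := Metric.isOpen_iff.1 hopen y₀ hv
    have := hle (y₀ - ε / 2) (hball (by
      rw [Metric.mem_ball, Real.dist_eq]; exact abs_lt.2 ⟨by linarith, by linarith⟩))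
    linarith
  obtain ⟨x₀, hx₀⟩ := hH y₀
  obtain ⟨hs, huniq⟩ := hbd x₀ y₀ hx₀ hy₀v hcl
  have hQy₀ : 0 ≤ Q.eval y₀ :=
    closure_minimal (t := {z | 0 ≤ Q.eval z}) (fun z hz => hcon z hz)
      (isClosed_le continuous_const Q.continuous) hcl
  have hPx₀ : 0 ≤ P.eval x₀ := by rw [← sign_nonneg_iff, hs]; exact sign_nonneg_iff.2 hQy₀
  have hne : G x₀ ≠ G x := by rw [hx₀, hx]; exact hy₀v
  have hlt : x₀ < x := by
    rcases lt_trichotomy x₀ x with h | h | h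
    · exact h
    · exact absurd (congrArg G h) hne
    · exact absurd (hord _ _ _ _ hy hx₀ hne.symm h) (not_lt.2 (hle y hyJ))
  -- `P` increases from `x₀`, where it is nonnegative, to `x`: a point between them outside the
  -- fibre would correspond to some `z > y₀` lying below the whole fibre, contradicting the choice
  -- of `y₀` as infimum.
  have := eval_lt_eval_of_derivative_pos hlt fun t ht => hP t <| by
    by_contra htv
    obtain ⟨z, hz⟩ := hG t
    have h1 : y₀ < z := hord _ _ _ _ hx₀ hz (fun e => ht.1.ne' (huniq t e.symm)) ht.1
    have h2 : z ≤ y₀ := le_csInf ⟨y, hyJ⟩ fun w hw =>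
      (hord _ _ _ _ hz (hx.trans (Eq.symm hw)) (by rwa [hx]) ht.2).le
    linarith
  linarith

/-- The sign of `P` on a fibre of `G` is also a sign of `Q` on the fibre of `H`, if `P` and `Q` are
strictly monotone of the same kind on the fibres. -/
theorem exists_sign_eval_eq_of_fibre {V : Type*} {G H : ℝ → V} {P Q : ℝ[X]} {v : V} {x : ℝ}
    (hG : ∀ x, ∃ y, G x = H y) (hH : ∀ y, ∃ x, G x = H y)
    (hord : ∀ x x' y y', G x = H y → G x' = H y' → G x ≠ G x' → x < x' → y < y')
    (hopen : IsOpen {y | H y = v}) (hconn : Set.OrdConnected {y | H y = v})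
    {r : ℝ} (hr : r ≠ 0)
    (hP : ∀ t, G t = v → 0 < r * P.derivative.eval t)
    (hQ : ∀ t, H t = v → 0 < r * Q.derivative.eval t)
    (hQ0 : Q.natDegree ≠ 0)
    (hbd : ∀ x y, G x = H y → H y ≠ v → y ∈ closure {y | H y = v} →
      SignType.sign (P.eval x) = SignType.sign (Q.eval y) ∧ ∀ x', G x' = G x → x' = x)
    (hx : G x = v) : ∃ y, H y = v ∧ SignType.sign (P.eval x) = SignType.sign (Q.eval y) := by
  have key : ∀ s : ℝ, s ≠ 0 → s * P.eval x ≤ 0 → ∃ y, H y = v ∧ s * Q.eval y < 0 := by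
    intro s hs hsx
    -- The reflection `t ↦ e * t` is chosen so that `s * P (e * t)` and `s * Q (e * t)` are
    -- increasing on the fibres.
    obtain ⟨e, he, hee, hpos⟩ : ∃ e : ℝ, (e = 1 ∨ e = -1) ∧ e * e = 1 ∧ 0 < s * e * r := by
      rcases lt_or_gt_of_ne (mul_ne_zero hs hr) with h | h
      · exact ⟨-1, Or.inr rfl, by norm_num, by linarith⟩
      · exact ⟨1, Or.inl rfl, by norm_num, by linarith⟩
    have hecont : Continuous fun y : ℝ => e * y := continuous_const.mul continuous_id
    have hcancel : ∀ t : ℝ, e * (e * t) = t := fun t => by rw [← mul_assoc, hee, one_mul]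
    have hder : ∀ R : ℝ[X], ∀ t, 0 < r * R.derivative.eval (e * t) →
        0 < (C s * R.comp (C e * X)).derivative.eval t := fun R t ht => by
      simp only [derivative_mul, derivative_C, derivative_comp, derivative_X, zero_mul, zero_add,
        mul_one, eval_mul, eval_C, eval_comp, eval_X]
      have : s * (e * R.derivative.eval (e * t)) * (r * r) =
          s * e * r * (r * R.derivative.eval (e * t)) := by ring
      exact pos_of_mul_pos_left (this ▸ mul_pos hpos ht) (mul_self_nonneg r)
    have := exists_eval_neg_of_fibre (G := fun t => G (e * t)) (H := fun t => H (e * t))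
      (P := C s * P.comp (C e * X)) (Q := C s * Q.comp (C e * X)) (v := v) (x := e * x)
      (fun x => (hG (e * x)).imp' (fun y => e * y) (fun y hy => by rwa [hcancel]))
      (fun y => (hH (e * y)).imp' (fun x => e * x) (fun y hy => by rwa [hcancel]))
      (fun x x' y y' h h' hne hlt => by
        rcases he with rfl | rfl
        · simpa using hord _ _ _ _ h h' hne (by simpa using hlt)
        · simpa using hord _ _ _ _ h' h hne.symm (by simpa using hlt))
      (hopen.preimage hecont)
      ⟨fun y hy y' hy' t ht => by
        rcases he with rfl | rfl
        · exact hconn.out hy hy' ⟨by linarith [ht.1], by linarith [ht.2]⟩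
        · exact hconn.out hy' hy ⟨by linarith [ht.2], by linarith [ht.1]⟩⟩
      (fun t ht => hder P t (hP _ ht)) (fun t ht => hder Q t (hQ _ ht))
      (by
        have he0 : e ≠ 0 := fun h => by simp [h] at hee
        rw [natDegree_C_mul hs, natDegree_comp, natDegree_C_mul_X e he0, mul_one]
        exact hQ0)
      (fun x y hxy hy hcl => by
        obtain ⟨h1, h2⟩ := hbd _ _ hxy hy (map_mem_closure hecont hcl (fun t ht => ht))
        refine ⟨by simp [sign_mul, h1], fun x' hx' => ?_⟩
        rw [← hcancel x', h2 _ hx', hcancel])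
      (by simpa [hcancel] using hx) (by simpa [hcancel] using hsx)
    obtain ⟨y, hy, hyn⟩ := this
    exact ⟨e * y, hy, by simpa using hyn⟩
  rcases lt_trichotomy (P.eval x) 0 with h | h | h
  · obtain ⟨y, hy, hyn⟩ := key 1 one_ne_zero (by linarith)
    exact ⟨y, hy, by rw [sign_neg h, sign_neg (by linarith)]⟩
  -- Here `Q` takes both strict signs on the fibre, which is an interval, so it vanishes there.
  · obtain ⟨y, hy, hyn⟩ := key 1 one_ne_zero (by linarith)
    obtain ⟨z, hz, hzn⟩ := key (-1) (by norm_num) (by linarith)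
    have hIVT := intermediate_value_uIcc (a := y) (b := z) (f := fun t => Q.eval t) Q.continuousOn
    obtain ⟨t, ht, ht0⟩ := hIVT (Set.mem_uIcc.2 (Or.inl ⟨by linarith, by linarith⟩) :
      (0 : ℝ) ∈ Set.uIcc (Q.eval y) (Q.eval z))
    exact ⟨t, hconn.uIcc_subset hy hz ht, by simp only at ht0; rw [h, ht0]⟩
  · obtain ⟨y, hy, hyn⟩ := key (-1) (by norm_num) (by linarith)
    exact ⟨y, hy, by rw [sign_pos h, sign_pos (by linarith)]⟩

end SignConditions

/-! ### Pseudo-division and transfer of sign vectors -/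

section SignTransfer

open Polynomial

variable {A : Type*} [CommRing A]

/-- `r` is a pseudo-remainder of `p` modulo `q`, of degree less than that of `q`; the exponent of
the leading coefficient of `q` is even, so that signs are preserved. -/
def IsPseudoRem (p q r : A[X]) : Prop :=
  r.natDegree < q.natDegree ∧ ∃ (k : ℕ) (h : A[X]), C (q.leadingCoeff ^ (2 * k)) * p = h * q + r

theorem exists_isPseudoRem (p : A[X]) {q : A[X]} (hq : q.natDegree ≠ 0) :
    ∃ r, IsPseudoRem p q r := by
  induction hn : p.natDegree using Nat.strong_induction_on generalizing p with
  | _ n ih =>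
    subst hn
    by_cases hlt : p.natDegree < q.natDegree
    · exact ⟨p, hlt, 0, 0, by simp⟩
    · rw [not_lt] at hlt
      set c := q.leadingCoeff with hc
      set e := p.natDegree - q.natDegree with he
      set p₁ := C c * p - C p.leadingCoeff * X ^ e * q with hp₁
      have hdeg : p₁.natDegree < p.natDegree := by
        refine lt_of_le_of_ne ?_ ?_
        · refine (natDegree_sub_le _ _).trans (max_le (natDegree_C_mul_le _ _) ?_)
          rw [mul_assoc]
          refine (natDegree_C_mul_le _ _).trans (natDegree_mul_le.trans ?_)
          have := natDegree_X_pow_le (R := A) e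
          omega
        · intro heq
          have h0 : p₁.coeff p.natDegree = 0 := by
            have : p.natDegree = q.natDegree + e := by omega
            rw [hp₁, coeff_sub, coeff_C_mul, mul_assoc, coeff_C_mul, mul_comm (X ^ e) q]
            nth_rewrite 2 [this]
            rw [coeff_mul_X_pow, coeff_natDegree, coeff_natDegree, mul_comm, sub_self]
          rw [← heq, coeff_natDegree, leadingCoeff_eq_zero] at h0
          rw [h0, natDegree_zero] at heq
          omega
      obtain ⟨r, hr, k, h, hk⟩ := ih _ hdeg p₁ rfl
      -- Cancelling the leading term costs one factor `c`; a second one is inserted to keep the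
      -- exponent even.
      refine ⟨C c * r, (natDegree_C_mul_le _ _).trans_lt hr, k + 1,
        C c * (h + C (c ^ (2 * k)) * (C p.leadingCoeff * X ^ e)), ?_⟩
      have h2 : C (c ^ (2 * (k + 1))) = C c * C c * C (c ^ (2 * k)) := by
        rw [← C_mul, ← C_mul]; congr 1; ring
      rw [h2]
      linear_combination C c * hk

theorem IsPseudoRem.sign_eval_map {p q r : A[X]} (h : IsPseudoRem p q r) {a : A →+* ℝ} {x : ℝ}
    (hc : a q.leadingCoeff ≠ 0) (hq : (q.map a).eval x = 0) :
    SignType.sign ((p.map a).eval x) = SignType.sign ((r.map a).eval x) := by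
  obtain ⟨-, k, h, hk⟩ := h
  have h1 := congrArg (fun s => (s.map a).eval x) hk
  simp only [Polynomial.map_mul, Polynomial.map_add, map_C, eval_mul, eval_add, eval_C, hq,
    mul_zero, zero_add] at h1
  rw [← h1, sign_mul, map_pow, sign_pos ((even_two_mul k).pow_pos hc), one_mul]

/-- Stability under derivation, removal of the leading term and pseudo-division. -/
structure RemainderClosed (T : Set A[X]) : Prop where
  derivative_mem : ∀ p ∈ T, p.natDegree ≠ 0 → derivative p ∈ T
  eraseLead_mem : ∀ p ∈ T, p.natDegree ≠ 0 → p.eraseLead ∈ T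
  exists_rem : ∀ p ∈ T, ∀ q ∈ T, q.natDegree ≠ 0 → ∃ r ∈ T, IsPseudoRem p q r

theorem natDegree_eraseLead_lt {p : A[X]} (hp : p.natDegree ≠ 0) :
    p.eraseLead.natDegree < p.natDegree :=
  (eraseLead_natDegree_le p).trans_lt (Nat.sub_lt (Nat.pos_of_ne_zero hp) one_pos)

/-- Each operation lowers the degree below that of the polynomial, or of the divisor. If results are
missing only in degrees at most `d + 1`, adjoining those of degree at most `d` leaves only degrees
at most `d` to treat; at `d = 0` nothing is missing. -/
theorem exists_remainderClosed_of_natDegree_le (d : ℕ) (S : Set A[X]) (hfin : S.Finite)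
    (h₁ : ∀ p ∈ S, p.natDegree ≠ 0 → derivative p ∈ S ∨ p.natDegree ≤ d)
    (h₂ : ∀ p ∈ S, p.natDegree ≠ 0 → p.eraseLead ∈ S ∨ p.natDegree ≤ d)
    (h₃ : ∀ p ∈ S, ∀ q ∈ S, q.natDegree ≠ 0 → (∃ r ∈ S, IsPseudoRem p q r) ∨ q.natDegree ≤ d) :
    ∃ T, S ⊆ T ∧ T.Finite ∧ RemainderClosed T := by
  classical
  induction d generalizing S with
  | zero =>
    exact ⟨S, subset_rfl, hfin, fun p hp h0 => (h₁ p hp h0).resolve_right (by omega),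
      fun p hp h0 => (h₂ p hp h0).resolve_right (by omega),
      fun p hp q hq h0 => (h₃ p hp q hq h0).resolve_right (by omega)⟩
  | succ d ih =>
    choose! rem hrem using fun (p q : A[X]) (hq : q.natDegree ≠ 0) => exists_isPseudoRem p hq
    set N : Set A[X] := {r | r ∈ (derivative '' S ∪ eraseLead '' S ∪ Set.image2 rem S S) ∧
      r.natDegree ≤ d} with hN
    have hNfin : N.Finite := (((hfin.image _).union (hfin.image _)).union
      (hfin.image2 _ hfin)).subset fun r hr => hr.1
    refine (ih (S ∪ N) (hfin.union hNfin) ?_ ?_ ?_).imp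
      fun T hT => ⟨Set.subset_union_left.trans hT.1, hT.2⟩
    · rintro p (hp | hp) h0
      · refine Or.inl ((h₁ p hp h0).imp id fun hd => ⟨Or.inl (Or.inl ⟨p, hp, rfl⟩), ?_⟩)
        exact Nat.le_of_lt_succ ((natDegree_derivative_lt h0).trans_le hd)
      · exact Or.inr hp.2
    · rintro p (hp | hp) h0
      · refine Or.inl ((h₂ p hp h0).imp id fun hd => ⟨Or.inl (Or.inr ⟨p, hp, rfl⟩), ?_⟩)
        exact Nat.le_of_lt_succ ((natDegree_eraseLead_lt h0).trans_le hd)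
      · exact Or.inr hp.2
    · rintro p hp q (hq | hq) h0
      · by_cases hlt : p.natDegree < q.natDegree
        · exact Or.inl ⟨p, hp, hlt, 0, 0, by simp⟩
        rcases hp with hp | hp
        · rcases h₃ p hp q hq h0 with ⟨r, hr, h⟩ | hd
          · exact Or.inl ⟨r, Or.inl hr, h⟩
          · exact Or.inl ⟨rem p q, Or.inr ⟨Or.inr ⟨p, hp, q, hq, rfl⟩,
              Nat.le_of_lt_succ ((hrem p q h0).1.trans_le hd)⟩, hrem p q h0⟩
        · exact Or.inr ((not_lt.1 hlt).trans hp.2)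
      · exact Or.inr hq.2

theorem exists_remainderClosed {S : Set A[X]} (hfin : S.Finite) :
    ∃ T, S ⊆ T ∧ T.Finite ∧ RemainderClosed T := by
  obtain ⟨d, hd⟩ := (hfin.image natDegree).bddAbove
  have hd' : ∀ p ∈ S, p.natDegree ≤ d := fun p hp => hd ⟨p, hp, rfl⟩
  exact exists_remainderClosed_of_natDegree_le d S hfin (fun p hp _ => Or.inr (hd' p hp))
    (fun p hp _ => Or.inr (hd' p hp)) (fun _ _ q hq _ => Or.inr (hd' q hq))

/-- The coefficients of the elements of `T` have the same signs along `a` and `b`. -/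
def CoeffSignEq (T : Set A[X]) (a b : A →+* ℝ) : Prop :=
  ∀ p ∈ T, ∀ i, SignType.sign (a (p.coeff i)) = SignType.sign (b (p.coeff i))

theorem CoeffSignEq.symm {T : Set A[X]} {a b : A →+* ℝ} (h : CoeffSignEq T a b) :
    CoeffSignEq T b a := fun p hp i => (h p hp i).symm

theorem CoeffSignEq.map_eq_zero_iff {T : Set A[X]} {a b : A →+* ℝ} (h : CoeffSignEq T a b)
    {p : A[X]} (hp : p ∈ T) : p.map a = 0 ↔ p.map b = 0 := by
  simp only [Polynomial.ext_iff, coeff_map, coeff_zero]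
  refine forall_congr' fun i => ?_
  rw [← sign_eq_zero_iff, h p hp i, sign_eq_zero_iff]

theorem map_eraseLead_of_leadingCoeff_eq_zero {p : A[X]} {a : A →+* ℝ}
    (h : a p.leadingCoeff = 0) : p.eraseLead.map a = p.map a := by
  rw [← self_sub_C_mul_X_pow, Polynomial.map_sub, Polynomial.map_mul, map_C, h, C_0, zero_mul,
    sub_zero]

/-- At a root of a polynomial of lower degree, the sign of `p` is determined by the signs of
polynomials of lower degree. -/
theorem SignEq.sign_eval_eq_of_root {T F : Set A[X]} (hT : RemainderClosed T) (hFT : F ⊆ T)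
    {p : A[X]} (hp : p ∈ T) (hlow : ∀ q ∈ T, q.natDegree < p.natDegree → q ∈ F)
    {a b : A →+* ℝ} (hab : CoeffSignEq T a b) {x y : ℝ} (h : SignEq F a b x y)
    {q : A[X]} (hq : q ∈ F) (hqp : q.natDegree ≤ p.natDegree) (hq0 : q.map a ≠ 0)
    (hroot : (q.map a).eval x = 0) :
    SignType.sign ((p.map a).eval x) = SignType.sign ((p.map b).eval y) := by
  induction hn : q.natDegree using Nat.strong_induction_on generalizing q with
  | _ n ih =>
    subst hn
    have hd : q.natDegree ≠ 0 := fun hd => by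
      rw [natDegree_eq_zero] at hd
      obtain ⟨c, rfl⟩ := hd
      rw [map_C, eval_C] at hroot
      rw [map_C, hroot, C_0] at hq0
      exact hq0 rfl
    -- Degrees are formal: if the leading coefficient specialises to zero, erasing it leaves the
    -- specialised polynomial unchanged.
    by_cases hc : a q.leadingCoeff = 0
    · have hlt := natDegree_eraseLead_lt hd
      have hmap := map_eraseLead_of_leadingCoeff_eq_zero hc
      exact ih _ hlt (hlow _ (hT.eraseLead_mem q (hFT hq) hd) (hlt.trans_le hqp))
        (hlt.le.trans hqp) (hmap ▸ hq0) (hmap ▸ hroot) rfl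
    · obtain ⟨r, hr, hrem⟩ := hT.exists_rem p hp q (hFT hq) hd
      have hcb : b q.leadingCoeff ≠ 0 := by
        rw [← sign_ne_zero, leadingCoeff, ← hab q (hFT hq), sign_ne_zero]
        exact hc
      have hroot' : (q.map b).eval y = 0 := by
        rw [← sign_eq_zero_iff, ← h q hq, hroot, sign_zero]
      rw [hrem.sign_eval_map hc hroot, hrem.sign_eval_map hcb hroot',
        h r (hlow r hr (hrem.1.trans_le hqp))]

/-- A point at which some nonzero element of `F` vanishes is alone in its sign class. -/
theorem SignEq.eq_of_root {F : Set A[X]} (hF : DerivClosed F) {a : A →+* ℝ} {x x' : ℝ}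
    (h : SignEq F a a x x') {q : A[X]} (hq : q ∈ F) (hq0 : q.map a ≠ 0)
    (hroot : (q.map a).eval x = 0) : x = x' := by
  wlog hlt : x < x' generalizing x x'
  · rcases lt_trichotomy x x' with h' | h' | h'
    · exact this h hroot h'
    · exact h'
    · refine (this h.symm ?_ h').symm
      rw [← sign_eq_zero_iff, ← h q hq, hroot, sign_zero]
  · refine absurd (eq_zero_of_infinite_isRoot _ ((Set.Icc_infinite hlt).mono fun t ht => ?_)) hq0
    have := h.of_mem_Icc hF ht q hq
    rw [hroot, sign_zero] at this
    exact sign_eq_zero_iff.1 this.symm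

theorem eventually_sign_eq {P : ℝ[X]} {y : ℝ} (h : P.eval y ≠ 0) :
    ∀ᶠ t in 𝓝 y, SignType.sign (P.eval t) = SignType.sign (P.eval y) := by
  rcases lt_or_gt_of_ne h with h | h
  · filter_upwards [P.continuous.continuousAt.eventually (eventually_lt_nhds h)] with t ht
    rw [sign_neg h, sign_neg ht]
  · filter_upwards [P.continuous.continuousAt.eventually (eventually_gt_nhds h)] with t ht
    rw [sign_pos h, sign_pos ht]

/-- Signs of a further polynomial of maximal degree can be transferred from `a` to `b`. -/
theorem exists_signEq_and_sign_eq {T : Set A[X]} (hT : RemainderClosed T) {F : Set A[X]}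
    (hfin : F.Finite) (hFT : F ⊆ T) {p : A[X]} (hp : p ∈ T)
    (hlow : ∀ q ∈ T, q.natDegree < p.natDegree → q ∈ F)
    (hle : ∀ q ∈ F, q.natDegree ≤ p.natDegree) {a b : A →+* ℝ} (hab : CoeffSignEq T a b)
    (hG : ∀ x, ∃ y, SignEq F a b x y) (hH : ∀ y, ∃ x, SignEq F a b x y) (x : ℝ) :
    ∃ y, SignEq F a b x y ∧
      SignType.sign ((p.map a).eval x) = SignType.sign ((p.map b).eval y) := by
  have hF : DerivClosed F := fun q hq h0 => hlow _ (hT.derivative_mem q (hFT hq) h0)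
    ((natDegree_derivative_lt h0).trans_le (hle q hq))
  by_cases hd : p.natDegree = 0
  · obtain ⟨y, hy⟩ := hG x
    refine ⟨y, hy, ?_⟩
    have := hab p hp 0
    rw [natDegree_eq_zero] at hd
    obtain ⟨c, rfl⟩ := hd
    simpa using this
  by_cases hca : a p.leadingCoeff = 0
  · obtain ⟨y, hy⟩ := hG x
    have hcb : b p.leadingCoeff = 0 := by
      rw [← sign_eq_zero_iff, leadingCoeff, ← hab p hp, sign_eq_zero_iff]
      exact hca
    refine ⟨y, hy, ?_⟩
    rw [← map_eraseLead_of_leadingCoeff_eq_zero hca, ← map_eraseLead_of_leadingCoeff_eq_zero hcb]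
    exact hy _ (hlow _ (hT.eraseLead_mem p hp hd) (natDegree_eraseLead_lt hd))
  -- At a root the sign of `p` is forced. Otherwise the sign class is open, `p` is strictly monotone
  -- on it, and its boundary points are roots.
  by_cases hroot : ∃ q ∈ F, q.map a ≠ 0 ∧ (q.map a).eval x = 0
  · obtain ⟨y, hy⟩ := hG x
    obtain ⟨q, hq, hq0, hqx⟩ := hroot
    exact ⟨y, hy, hy.sign_eval_eq_of_root hT hFT hp hlow hab hq (hle q hq) hq0 hqx⟩
  push Not at hroot
  have hcb : b p.leadingCoeff ≠ 0 := by
    rw [← sign_ne_zero, leadingCoeff, ← hab p hp, sign_ne_zero]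
    exact hca
  have hp' : derivative p ∈ F := hlow _ (hT.derivative_mem p hp hd) (natDegree_derivative_lt hd)
  have hp'0 : (derivative p).map a ≠ 0 := by
    rw [← derivative_map]
    intro h
    have := derivative_eq_zero.1 h
    rw [natDegree_map_of_leadingCoeff_ne_zero _ hca] at this
    exact hd this
  set G : ℝ → F → SignType := fun x q => SignType.sign ((q.1.map a).eval x) with hGdef
  set H : ℝ → F → SignType := fun y q => SignType.sign ((q.1.map b).eval y) with hHdef
  have hGH : ∀ x y, G x = H y ↔ SignEq F a b x y := fun x y =>
    ⟨fun h q hq => congrFun h ⟨q, hq⟩, fun h => funext fun q => h q.1 q.2⟩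
  have hGG : ∀ x y, G x = G y ↔ SignEq F a a x y := fun x y =>
    ⟨fun h q hq => congrFun h ⟨q, hq⟩, fun h => funext fun q => h q.1 q.2⟩
  have hHH : ∀ x y, H x = H y ↔ SignEq F b b x y := fun x y =>
    ⟨fun h q hq => congrFun h ⟨q, hq⟩, fun h => funext fun q => h q.1 q.2⟩
  have hopen : IsOpen {t | H t = G x} := by
    rw [isOpen_iff_mem_nhds]
    intro t ht
    have : ∀ᶠ s in 𝓝 t, ∀ q ∈ F,
        SignType.sign ((q.map b).eval s) = SignType.sign ((q.map b).eval t) := by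
      rw [eventually_all_finite hfin]
      intro q hq
      by_cases hqb : q.map b = 0
      · simp [hqb]
      · refine eventually_sign_eq ?_
        rw [← sign_ne_zero]
        refine (congrFun ht ⟨q, hq⟩).trans_ne (sign_ne_zero.2 ?_)
        exact hroot q hq (fun h => hqb ((hab.map_eq_zero_iff (hFT hq)).1 h))
    filter_upwards [this] with s hs
    exact ((hHH s t).2 hs).trans ht
  have hconn : Set.OrdConnected {t | H t = G x} := ⟨fun s hs t ht u hu => by
    have hst : SignEq F b b s t := (hHH s t).1 (Eq.trans hs (Eq.symm ht))
    exact ((hHH s u).2 (hst.of_mem_Icc hF hu)).symm.trans hs⟩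
  obtain ⟨z, hz, hzs⟩ := exists_sign_eval_eq_of_fibre (P := p.map a) (Q := p.map b) (v := G x)
    (x := x) (r := ((derivative p).map a).eval x)
    (fun x => (hG x).imp fun y => (hGH x y).2) (fun y => (hH y).imp fun x => (hGH x y).2)
    (fun s s' t t' h h' hne hlt => SignEq.lt_of_lt hF ((hGH _ _).1 h) ((hGH _ _).1 h')
      (fun h => hne ((hGG _ _).2 h)) hlt) hopen hconn (hroot _ hp' hp'0)
    (fun t ht => by
      have h1 := congrFun ht ⟨_, hp'⟩
      simp only [hGdef] at h1
      rw [derivative_map, ← sign_eq_one_iff, sign_mul, h1, ← sign_mul, sign_eq_one_iff]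
      exact mul_self_pos.2 (hroot _ hp' hp'0))
    (fun t ht => by
      have h1 := congrFun ht ⟨_, hp'⟩
      simp only [hGdef, hHdef] at h1
      rw [derivative_map, ← sign_eq_one_iff, sign_mul, h1, ← sign_mul, sign_eq_one_iff]
      exact mul_self_pos.2 (hroot _ hp' hp'0))
    (by rwa [natDegree_map_of_leadingCoeff_ne_zero _ hcb])
    (fun s t hst hne hcl => by
      have hst' := (hGH s t).1 hst
      obtain ⟨q, hqne⟩ : ∃ q, H t q ≠ G x q := by
        by_contra! h
        exact hne (funext h)
      have hqt : (q.1.map b).eval t = 0 := by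
        by_contra h0
        obtain ⟨u, hu1, hu2⟩ := (mem_closure_iff_frequently.1 hcl).and_eventually
          (eventually_sign_eq h0) |>.exists
        exact hqne (hu2.symm.trans (congrFun hu1 q))
      have hqs : (q.1.map a).eval s = 0 := by
        rw [← sign_eq_zero_iff, hst' q.1 q.2, hqt, sign_zero]
      have hq0 : q.1.map a ≠ 0 := fun h0 => hqne <| by
        simp only [hHdef, hGdef, hqt, h0, eval_zero]
      refine ⟨hst'.sign_eval_eq_of_root hT hFT hp hlow hab q.2 (hle _ q.2) hq0 hqs,
        fun s' hs' => ?_⟩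
      exact (((hGG _ _).1 hs'.symm).eq_of_root hF q.2 hq0 hqs).symm)
    rfl
  exact ⟨z, (hGH x z).1 hz.symm, hzs⟩

/-- If the coefficients of the elements of a finite remainder-closed set have the same signs along
`a` and `b`, the same sign conditions are realised along `a` and `b`. -/
theorem exists_signEq {T : Set A[X]} (hT : RemainderClosed T) (hfin : T.Finite) {a b : A →+* ℝ}
    (hab : CoeffSignEq T a b) (x : ℝ) : ∃ y, SignEq T a b x y := by
  classical
  suffices H : ∀ F : Finset A[X], (F : Set A[X]) ⊆ T →
      (∀ q ∈ T, ∀ p ∈ F, q.natDegree < p.natDegree → q ∈ F) →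
      ∀ a b : A →+* ℝ, CoeffSignEq T a b → ∀ x, ∃ y, SignEq (F : Set A[X]) a b x y by
    simpa using H hfin.toFinset (by simp) (by simp +contextual) a b hab x
  intro F
  refine Finset.induction_on_max_value natDegree F ?_ ?_
  · exact fun _ _ a b _ x => ⟨x, by simp [SignEq]⟩
  · intro p F hpF hmax ih hFT hdown a b hab x
    rw [Finset.coe_insert, Set.insert_subset_iff] at hFT
    -- Since `p` has maximal degree, removing it keeps `F` closed under passing to elements of `T`
    -- of lower degree.
    have ih' := ih hFT.2 fun q hq r hr hlt =>
      Finset.mem_of_mem_insert_of_ne (hdown q hq r (Finset.mem_insert_of_mem hr) hlt)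
        (by rintro rfl; exact absurd (hmax r hr) (not_le.2 hlt))
    obtain ⟨y, hy, hys⟩ := exists_signEq_and_sign_eq hT F.finite_toSet hFT.2 hFT.1
      (fun q hq hlt => Finset.mem_of_mem_insert_of_ne (hdown q hq p (Finset.mem_insert_self _ _)
        hlt) (by rintro rfl; exact lt_irrefl _ hlt)) hmax hab (ih' a b hab)
      (fun y => (ih' b a hab.symm y).imp fun x hx => hx.symm) x
    refine ⟨y, ?_⟩
    rw [Finset.coe_insert]
    rintro q (rfl | hq)
    · exact hys
    · exact hy q hq

end SignTransfer

/-! ### Quantifier elimination for sign-determined sets -/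

section Semialgebraic

variable {ι κ : Type*}

/-- Membership in `S` depends only on the signs of finitely many polynomials. -/
def SignDetermined (S : Set (ι → ℝ)) : Prop :=
  ∃ P : Set (MvPolynomial ι ℝ), P.Finite ∧ ∀ x y : ι → ℝ,
    (∀ p ∈ P, SignType.sign (MvPolynomial.eval x p) = SignType.sign (MvPolynomial.eval y p)) →
      x ∈ S → y ∈ S

namespace SignDetermined

theorem inter {S T : Set (ι → ℝ)} (hS : SignDetermined S) (hT : SignDetermined T) :
    SignDetermined (S ∩ T) := by
  obtain ⟨P, hP, h⟩ := hS
  obtain ⟨Q, hQ, h'⟩ := hT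
  exact ⟨P ∪ Q, hP.union hQ, fun x y hxy hx => ⟨h x y (fun p hp => hxy p (Or.inl hp)) hx.1,
    h' x y (fun p hp => hxy p (Or.inr hp)) hx.2⟩⟩

theorem compl {S : Set (ι → ℝ)} (hS : SignDetermined S) : SignDetermined Sᶜ := by
  obtain ⟨P, hP, h⟩ := hS
  exact ⟨P, hP, fun x y hxy hx hy => hx (h y x (fun p hp => (hxy p hp).symm) hy)⟩

theorem iInter {α : Type*} [Finite α] {S : α → Set (ι → ℝ)} (hS : ∀ i, SignDetermined (S i)) :
    SignDetermined {x | ∀ i, x ∈ S i} := by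
  choose P hP h using hS
  exact ⟨⋃ i, P i, Set.finite_iUnion hP, fun x y hxy hx i =>
    h i x y (fun p hp => hxy p (Set.mem_iUnion.2 ⟨i, hp⟩)) (hx i)⟩

theorem preimage_comp {S : Set (κ → ℝ)} (hS : SignDetermined S) (e : κ → ι) :
    SignDetermined {x : ι → ℝ | x ∘ e ∈ S} := by
  obtain ⟨P, hP, h⟩ := hS
  refine ⟨MvPolynomial.rename e '' P, hP.image _, fun x y hxy hx => h _ _ (fun p hp => ?_) hx⟩
  simpa [MvPolynomial.eval_rename] using hxy _ ⟨p, hp, rfl⟩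

/-- The Tarski–Seidenberg theorem, for one variable. -/
theorem exists_option {S : Set (Option ι → ℝ)} (hS : SignDetermined S) :
    SignDetermined {x : ι → ℝ | ∃ t : ℝ, (fun o => Option.elim o t x) ∈ S} := by
  obtain ⟨P, hP, h⟩ := hS
  obtain ⟨T, hST, hT, hTc⟩ := exists_remainderClosed
    (hP.image (MvPolynomial.optionEquivLeft ℝ ι))
  -- The coefficients of `T` suffice: if their signs agree at `x` and `y`, a witness over `x` has a
  -- counterpart over `y`.
  refine ⟨⋃ p ∈ T, (p.coeffs : Set (MvPolynomial ι ℝ)),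
    hT.biUnion fun p _ => Finset.finite_toSet _, ?_⟩
  rintro x y hxy ⟨t, ht⟩
  have hco : CoeffSignEq T (MvPolynomial.eval x) (MvPolynomial.eval y) := fun p hp i => by
    by_cases h0 : p.coeff i = 0
    · simp [h0]
    · exact hxy _ (Set.mem_biUnion hp (Polynomial.coeff_mem_coeffs h0))
  obtain ⟨s, hs⟩ := exists_signEq hTc hT hco t
  refine ⟨s, h _ _ (fun p hp => ?_) ht⟩
  rw [MvPolynomial.optionEquivLeft_elim_eval, MvPolynomial.optionEquivLeft_elim_eval]
  exact hs _ (hST ⟨p, hp, rfl⟩)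

theorem exists_sum (κ : Type*) [Finite κ] : ∀ {S : Set (ι ⊕ κ → ℝ)}, SignDetermined S →
    SignDetermined {x : ι → ℝ | ∃ y : κ → ℝ, Sum.elim x y ∈ S} := by
  induction κ using Finite.induction_empty_option with
  | of_equiv e ih =>
    intro S hS
    convert ih (hS.preimage_comp (Sum.map id e.symm)) using 1
    ext x
    refine ⟨fun ⟨y, hy⟩ => ⟨y ∘ e, ?_⟩, fun ⟨y, hy⟩ => ⟨y ∘ e.symm, ?_⟩⟩
    · simpa [Sum.elim_comp_map, Function.comp_assoc] using hy
    · simpa [Sum.elim_comp_map] using hy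
  | h_empty =>
    intro S hS
    convert hS.preimage_comp (Sum.elim id PEmpty.elim) using 1
    ext x
    have key : ∀ y, Sum.elim x y = x ∘ Sum.elim id PEmpty.elim := fun y => by
      ext (i | i)
      · rfl
      · exact i.elim
    exact ⟨fun ⟨y, hy⟩ => (key y ▸ hy :), fun h => ⟨PEmpty.elim, (key _).symm ▸ h⟩⟩
  | h_option ih =>
    rename_i α _
    intro S hS
    convert ih (hS.preimage_comp
      (Sum.elim (fun i => some (Sum.inl i)) (fun o => o.elim none (fun a => some (Sum.inr a))) :
        ι ⊕ Option α → Option (ι ⊕ α))).exists_option using 1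
    ext x
    have key : ∀ (y : α → ℝ) (t : ℝ), (fun o => Option.elim o t (Sum.elim x y)) ∘
        (Sum.elim (fun i => some (Sum.inl i)) (fun o => o.elim none (fun a => some (Sum.inr a))) :
        ι ⊕ Option α → Option (ι ⊕ α)) = Sum.elim x (fun o => Option.elim o t y) := fun y t => by
      ext (i | _ | i) <;> rfl
    simp only [Set.mem_ofPred_eq, key]
    refine ⟨fun ⟨y, hy⟩ => ⟨fun a => y (some a), y none, ?_⟩, fun ⟨y, t, hy⟩ => ⟨_, hy⟩⟩
    convert hy using 2
    ext (_ | i) <;> rfl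

/-- The Tarski–Seidenberg theorem, as elimination of an existential quantifier. -/
theorem setOf_exists [Finite κ] {Q : (ι → ℝ) → (κ → ℝ) → Prop}
    (h : SignDetermined {w : ι ⊕ κ → ℝ | Q (w ∘ Sum.inl) (w ∘ Sum.inr)}) :
    SignDetermined {x | ∃ y, Q x y} := by
  simpa using exists_sum κ h

theorem setOf_forall [Finite κ] {Q : (ι → ℝ) → (κ → ℝ) → Prop}
    (h : SignDetermined {w : ι ⊕ κ → ℝ | Q (w ∘ Sum.inl) (w ∘ Sum.inr)}) :
    SignDetermined {x | ∀ y, Q x y} := by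
  simpa [Set.compl_ofPred] using (setOf_exists (Q := fun x y => ¬ Q x y) h.compl).compl

end SignDetermined

/-! ### From sign-determined to semialgebraic sets -/

theorem IsSemialgebraic.empty {m : ℕ} : IsSemialgebraic (∅ : Set (Fin m → ℝ)) := by
  simpa using IsSemialgebraic.pos (0 : MvPolynomial (Fin m) ℝ)

theorem IsSemialgebraic.biUnion {m : ℕ} {α : Type*} {s : Set α} (hs : s.Finite)
    {S : α → Set (Fin m → ℝ)} (hS : ∀ i ∈ s, IsSemialgebraic (S i)) :
    IsSemialgebraic (⋃ i ∈ s, S i) := by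
  induction s, hs using Set.Finite.induction_on with
  | empty => simpa using IsSemialgebraic.empty
  | insert _ _ ih =>
    rw [Set.biUnion_insert]
    exact (hS _ (Set.mem_insert _ _)).union (ih fun i hi => hS i (Set.mem_insert_of_mem _ hi))

theorem IsSemialgebraic.biInter {m : ℕ} {α : Type*} {s : Set α} (hs : s.Finite)
    {S : α → Set (Fin m → ℝ)} (hS : ∀ i ∈ s, IsSemialgebraic (S i)) :
    IsSemialgebraic (⋂ i ∈ s, S i) := by
  simpa using (IsSemialgebraic.biUnion hs fun i hi => (hS i hi).compl).compl

theorem IsSemialgebraic.setOf_sign_eq {m : ℕ} (p : MvPolynomial (Fin m) ℝ) (s : SignType) :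
    IsSemialgebraic {x | SignType.sign (MvPolynomial.eval x p) = s} := by
  have hpos := IsSemialgebraic.pos p
  have hneg : IsSemialgebraic {x | MvPolynomial.eval x p < 0} := by
    simpa using IsSemialgebraic.pos (-p)
  rcases s.trichotomy with rfl | rfl | rfl
  · simpa only [sign_eq_neg_one_iff] using hneg
  · convert hpos.compl.inter hneg.compl using 1
    ext x
    simp [le_antisymm_iff]
  · simpa only [sign_eq_one_iff] using hpos

/-- Only finitely many sign vectors exist, and `S` is the union of the classes of those realised in
it. -/
theorem SignDetermined.isSemialgebraic {m : ℕ} {S : Set (Fin m → ℝ)} (hS : SignDetermined S) :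
    IsSemialgebraic S := by
  obtain ⟨P, hP, h⟩ := hS
  have := hP.to_subtype
  let σ : (Fin m → ℝ) → P → SignType := fun x p => SignType.sign (MvPolynomial.eval x p.1)
  have hSeq : S = ⋃ τ ∈ σ '' S, ⋂ p ∈ (Set.univ : Set P),
      {x | SignType.sign (MvPolynomial.eval x p.1) = τ p} := by
    ext y
    simp only [Set.mem_iUnion, Set.mem_iInter, Set.mem_ofPred_eq, exists_prop,
      Set.exists_mem_image]
    exact ⟨fun hy => ⟨y, hy, fun p _ => rfl⟩, fun ⟨x, hx, hxy⟩ =>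
      h x y (fun p hp => (hxy ⟨p, hp⟩ trivial).symm) hx⟩
  rw [hSeq]
  exact IsSemialgebraic.biUnion (Set.toFinite _) fun τ _ =>
    IsSemialgebraic.biInter Set.finite_univ fun p _ => IsSemialgebraic.setOf_sign_eq p.1 (τ p)

/-! ### Polynomial functions and their sign conditions -/

/-- Real polynomial functions. -/
def IsPolyFun (g : (ι → ℝ) → ℝ) : Prop := ∃ p : MvPolynomial ι ℝ, ∀ x, g x = MvPolynomial.eval x p

namespace IsPolyFun

variable {g h : (ι → ℝ) → ℝ}

theorem const (c : ℝ) : IsPolyFun (fun _ : ι → ℝ => c) := ⟨MvPolynomial.C c, by simp⟩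

theorem coord (i : ι) : IsPolyFun (fun x : ι → ℝ => x i) := ⟨MvPolynomial.X i, by simp⟩

theorem add (hg : IsPolyFun g) (hh : IsPolyFun h) : IsPolyFun (fun x => g x + h x) := by
  obtain ⟨p, hp⟩ := hg
  obtain ⟨q, hq⟩ := hh
  exact ⟨p + q, by simp [hp, hq]⟩

theorem mul (hg : IsPolyFun g) (hh : IsPolyFun h) : IsPolyFun (fun x => g x * h x) := by
  obtain ⟨p, hp⟩ := hg
  obtain ⟨q, hq⟩ := hh
  exact ⟨p * q, by simp [hp, hq]⟩

theorem neg (hg : IsPolyFun g) : IsPolyFun (fun x => -g x) := by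
  simpa using (const (-1)).mul hg

theorem sub (hg : IsPolyFun g) (hh : IsPolyFun h) : IsPolyFun (fun x => g x - h x) := by
  simpa [sub_eq_add_neg] using hg.add hh.neg

theorem sum {α : Type*} (s : Finset α) {g : α → (ι → ℝ) → ℝ} (hg : ∀ i, IsPolyFun (g i)) :
    IsPolyFun (fun x => ∑ i ∈ s, g i x) := by
  choose p hp using hg
  exact ⟨∑ i ∈ s, p i, by simp [hp]⟩

theorem signDetermined_lt (hg : IsPolyFun g) (hh : IsPolyFun h) :
    SignDetermined {x | g x < h x} := by
  obtain ⟨p, hp⟩ := hh.sub hg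
  refine ⟨{p}, Set.finite_singleton p, fun x y hxy hx => ?_⟩
  simp only [Set.mem_singleton_iff, forall_eq, ← hp] at hxy
  rw [Set.mem_ofPred_eq, ← sub_pos, ← sign_eq_one_iff] at hx ⊢
  rwa [← hxy]

theorem signDetermined_eq (hg : IsPolyFun g) (hh : IsPolyFun h) :
    SignDetermined {x | g x = h x} := by
  convert (hg.signDetermined_lt hh).compl.inter (hh.signDetermined_lt hg).compl using 1
  ext x
  simp [le_antisymm_iff, and_comm]

end IsPolyFun

/-- Complex-valued functions whose real and imaginary parts are polynomial functions. -/
def IsComplexPolyFun (g : (ι → ℝ) → ℂ) : Prop :=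
  IsPolyFun (fun x => (g x).re) ∧ IsPolyFun (fun x => (g x).im)

namespace IsComplexPolyFun

variable {g h : (ι → ℝ) → ℂ}

theorem const (c : ℂ) : IsComplexPolyFun (fun _ : ι → ℝ => c) :=
  ⟨IsPolyFun.const _, IsPolyFun.const _⟩

theorem ofReal {g : (ι → ℝ) → ℝ} (hg : IsPolyFun g) : IsComplexPolyFun (fun x => (g x : ℂ)) :=
  ⟨by simpa using hg, by simpa using IsPolyFun.const 0⟩

theorem add (hg : IsComplexPolyFun g) (hh : IsComplexPolyFun h) :
    IsComplexPolyFun (fun x => g x + h x) :=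
  ⟨by simpa using hg.1.add hh.1, by simpa using hg.2.add hh.2⟩

theorem mul (hg : IsComplexPolyFun g) (hh : IsComplexPolyFun h) :
    IsComplexPolyFun (fun x => g x * h x) :=
  ⟨by simpa using (hg.1.mul hh.1).sub (hg.2.mul hh.2),
    by simpa using (hg.1.mul hh.2).add (hg.2.mul hh.1)⟩

theorem star (hg : IsComplexPolyFun g) : IsComplexPolyFun (fun x => star (g x)) :=
  ⟨by simpa using hg.1, by simpa using hg.2.neg⟩

theorem eval {σ : Type*} {z : σ → (ι → ℝ) → ℂ} (hz : ∀ i, IsComplexPolyFun (z i))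
    (p : MvPolynomial σ ℂ) : IsComplexPolyFun (fun x => MvPolynomial.eval (fun i => z i x) p) := by
  induction p using MvPolynomial.induction_on with
  | C c => simpa using const c
  | add p q hp hq => simpa using hp.add hq
  | mul_X p i hp => simpa using hp.mul (hz i)

theorem signDetermined_eq (hg : IsComplexPolyFun g) (hh : IsComplexPolyFun h) :
    SignDetermined {x | g x = h x} := by
  simp only [Complex.ext_iff]
  exact (hg.1.signDetermined_eq hh.1).inter (hg.2.signDetermined_eq hh.2)

end IsComplexPolyFun

end Semialgebraic

/-! ### The differential and the singular locus -/

namespace MixedPolynomial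

variable {n : ℕ}

/-- The real-linear maps `z ↦ z_k` and `z ↦ z̄_k`. -/
noncomputable def coordCLM (i : Fin n ⊕ Fin n) : EuclideanSpace ℂ (Fin n) →L[ℝ] ℂ :=
  Sum.elim (fun k => (EuclideanSpace.proj k : EuclideanSpace ℂ (Fin n) →L[ℂ] ℂ).restrictScalars ℝ)
    (fun k => (Complex.conjCLE : ℂ →L[ℝ] ℂ).comp
      ((EuclideanSpace.proj k : EuclideanSpace ℂ (Fin n) →L[ℂ] ℂ).restrictScalars ℝ)) i

theorem coordCLM_inl (k : Fin n) (z : EuclideanSpace ℂ (Fin n)) :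
    coordCLM (Sum.inl k) z = z k := rfl

theorem coordCLM_inr (k : Fin n) (z : EuclideanSpace ℂ (Fin n)) :
    coordCLM (Sum.inr k) z = star (z k) := rfl

theorem toFun_eq_eval_coordCLM (f : MixedPolynomial n) (z : EuclideanSpace ℂ (Fin n)) :
    toFun f z = MvPolynomial.eval (fun i => coordCLM i z) f := by
  unfold toFun
  congr 2
  ext (k | k) <;> rfl

theorem _root_.MvPolynomial.hasFDerivAt_eval_clm {E σ : Type*} [NormedAddCommGroup E]
    [NormedSpace ℝ E] [Fintype σ] (l : σ → E →L[ℝ] ℂ) (p : MvPolynomial σ ℂ) (z : E) :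
    HasFDerivAt (fun z => MvPolynomial.eval (fun i => l i z) p)
      (∑ i, MvPolynomial.eval (fun i => l i z) (MvPolynomial.pderiv i p) • l i) z := by
  classical
  induction p using MvPolynomial.induction_on with
  | C c =>
    simp only [MvPolynomial.eval_C]
    refine (hasFDerivAt_const c z).congr_fderiv ?_
    ext v
    simp
  | add p q hp hq =>
    simp only [map_add]
    refine (hp.add hq).congr_fderiv ?_
    ext v
    simp [add_mul, Finset.sum_add_distrib]
  | mul_X p j hp =>
    simp only [map_mul, MvPolynomial.eval_X]
    refine (hp.mul (l j).hasFDerivAt).congr_fderiv ?_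
    ext v
    simp [MvPolynomial.pderiv_X, Pi.single_apply, Finset.sum_add_distrib, Finset.mul_sum, add_mul,
      apply_ite, mul_assoc]

theorem hasFDerivAt_toFun (f : MixedPolynomial n) (z : EuclideanSpace ℂ (Fin n)) :
    HasFDerivAt (toFun f) (∑ k, (dz f k z • coordCLM (Sum.inl k) +
      dzbar f k z • coordCLM (Sum.inr k))) z := by
  have h := MvPolynomial.hasFDerivAt_eval_clm coordCLM f z
  simp only [← toFun_eq_eval_coordCLM, Fintype.sum_sum_type] at h
  rw [Finset.sum_add_distrib]
  exact h

theorem fderiv_toFun_apply (f : MixedPolynomial n) (z v : EuclideanSpace ℂ (Fin n)) :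
    fderiv ℝ (toFun f) z v = ∑ k, (dz f k z * v k + dzbar f k z * star (v k)) := by
  rw [(hasFDerivAt_toFun f z).fderiv]
  simp [coordCLM_inl, coordCLM_inr]

theorem continuous_toFun (f : MixedPolynomial n) : Continuous (toFun f) :=
  continuous_iff_continuousAt.2 fun z => (hasFDerivAt_toFun f z).continuousAt

/-- A proper real subspace of `ℂ` is killed by a nonzero functional `w ↦ Re (μ̄ w)`. On the
differential along `v` it gives the sum over `k` of the real parts of `(μ * star (dz f k z) + star μ
* dzbar f k z) * star (v k)`. -/
theorem mem_singularLocus_iff (f : MixedPolynomial n) (z : EuclideanSpace ℂ (Fin n)) :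
    z ∈ singularLocus f ↔
      ∃ μ : ℂ, μ ≠ 0 ∧ ∀ k, μ * star (dz f k z) + star μ * dzbar f k z = 0 := by
  constructor
  · intro hz
    have hlt : LinearMap.range (fderiv ℝ (toFun f) z : EuclideanSpace ℂ (Fin n) →ₗ[ℝ] ℂ) < ⊤ := by
      rw [lt_top_iff_ne_top]
      exact fun h => hz (LinearMap.range_eq_top.1 h)
    obtain ⟨φ, hφ, hle⟩ := Submodule.exists_le_ker_of_lt_top _ hlt
    have hφw : ∀ w : ℂ, φ w = w.re * φ 1 + w.im * φ Complex.I := fun w => by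
      conv_lhs => rw [← Complex.re_add_im w, mul_comm]
      have h1 : (w.re : ℂ) = w.re • (1 : ℂ) := by simp
      have h2 : Complex.I * (w.im : ℂ) = w.im • Complex.I := by simp [mul_comm]
      rw [h2, h1, map_add, map_smul, map_smul, smul_eq_mul, smul_eq_mul]
    have hv : ∀ (k : Fin n) (t : ℂ), φ (dz f k z * t + dzbar f k z * star t) = 0 := fun k t => by
      have h := hle ⟨EuclideanSpace.single k t, rfl⟩
      rw [LinearMap.mem_ker, ContinuousLinearMap.coe_coe, fderiv_toFun_apply,
        Finset.sum_eq_single k] at h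
      · simpa using h
      · intro j _ hj
        simp [hj]
      · simp
    refine ⟨⟨φ 1, φ Complex.I⟩, fun h0 => hφ ?_, fun k => ?_⟩
    · rw [Complex.ext_iff] at h0
      simp only [Complex.zero_re, Complex.zero_im] at h0
      ext w
      simp [hφw w, h0.1, h0.2]
    · have h1 := hv k 1
      have h2 := hv k Complex.I
      rw [hφw] at h1 h2
      simp at h1 h2
      apply Complex.ext
      · simp
        linarith
      · simp
        linarith
  · rintro ⟨μ, hμ, h⟩ hsurj
    obtain ⟨v, hv⟩ := hsurj μ
    rw [fderiv_toFun_apply] at hv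
    have h0 : (star μ * ∑ k, (dz f k z * v k + dzbar f k z * star (v k))).re = 0 := by
      rw [Finset.mul_sum, Complex.re_sum]
      refine Finset.sum_eq_zero fun k _ => ?_
      have hk := Complex.ext_iff.1 (h k)
      simp at hk ⊢
      linear_combination (v k).re * hk.1 + (v k).im * hk.2
    rw [hv] at h0
    refine hμ (Complex.normSq_eq_zero.1 ?_)
    rw [Complex.normSq_apply]
    simpa using h0

theorem singularLocus_subset_milnorSet (f : MixedPolynomial n) :
    singularLocus f ⊆ milnorSet f := fun z hz => by
  obtain ⟨μ, hμ, h⟩ := (mem_singularLocus_iff f z).1 hz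
  exact ⟨0, μ, hμ, fun k => by rw [h k]; simp⟩

/-- The equations for `μ` are homogeneous under real scaling, so `μ` may be taken on the unit
circle; projecting along a compact factor is a closed map. -/
theorem isClosed_singularLocus (f : MixedPolynomial n) : IsClosed (singularLocus f) := by
  have hset : singularLocus f = Prod.fst '' {q : EuclideanSpace ℂ (Fin n) × Metric.sphere (0 : ℂ) 1 |
      ∀ k, (q.2 : ℂ) * star (dz f k q.1) + star (q.2 : ℂ) * dzbar f k q.1 = 0} := by
    ext z
    rw [mem_singularLocus_iff]
    constructor
    · rintro ⟨μ, hμ, h⟩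
      refine ⟨(z, ⟨(‖μ‖⁻¹ : ℝ) * μ, by simp [hμ]⟩), fun k => ?_, rfl⟩
      have := congrArg (fun w => ((‖μ‖⁻¹ : ℝ) : ℂ) * w) (h k)
      simp only [mul_zero] at this
      refine Eq.trans ?_ this
      simp only [star_mul', Complex.star_def, Complex.conj_ofReal]
      ring
    · rintro ⟨⟨w, μ⟩, h, rfl⟩
      exact ⟨μ, ne_zero_of_mem_unit_sphere μ, h⟩
  rw [hset]
  refine isClosedMap_fst_of_compactSpace _ ?_
  simp only [Set.ofPred_forall]
  refine isClosed_iInter fun k => isClosed_eq ?_ continuous_const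
  have h1 : Continuous (dz f k) := continuous_toFun _
  have h2 : Continuous (dzbar f k) := continuous_toFun _
  fun_prop

/-! ### Asymptotic values and closedness -/

theorem mem_asymptoticValues_iff (f : MixedPolynomial n) (c : ℂ) :
    c ∈ asymptoticValues f ↔ ∀ r : ℝ, c ∈ closure (toFun f '' {z ∈ milnorSet f | r < ‖z‖}) := by
  constructor
  · rintro ⟨z, hz, hn, hc⟩ r
    refine mem_closure_of_tendsto hc ?_
    filter_upwards [hn.eventually_gt_atTop r] with j hj
    exact ⟨z j, ⟨hz j, hj⟩, rfl⟩
  · intro h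
    have : ∀ j : ℕ, ∃ z ∈ milnorSet f, (j : ℝ) < ‖z‖ ∧ dist (toFun f z) c < 1 / ((j : ℝ) + 1) := by
      intro j
      obtain ⟨_, ⟨z, hz, rfl⟩, hd⟩ := Metric.mem_closure_iff.1 (h j) (1 / ((j : ℝ) + 1)) (by positivity)
      exact ⟨z, hz.1, hz.2, by rwa [dist_comm]⟩
    choose z hz hn hd using this
    exact ⟨z, hz, tendsto_atTop_mono (fun j => (hn j).le) tendsto_natCast_atTop_atTop,
      tendsto_iff_dist_tendsto_zero.2 (squeeze_zero (fun _ => dist_nonneg) (fun j => (hd j).le)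
        tendsto_one_div_add_atTop_nhds_zero_nat)⟩

theorem isClosed_asymptoticValues (f : MixedPolynomial n) : IsClosed (asymptoticValues f) := by
  have : asymptoticValues f = ⋂ r : ℝ, closure (toFun f '' {z ∈ milnorSet f | r < ‖z‖}) := by
    ext c
    rw [mem_asymptoticValues_iff, Set.mem_iInter]
  rw [this]
  exact isClosed_iInter fun _ => isClosed_closure

theorem isClosed_image_singularLocus_union (f : MixedPolynomial n) :
    IsClosed (toFun f '' singularLocus f ∪ asymptoticValues f) := by
  rw [← closure_subset_iff_isClosed, closure_union, (isClosed_asymptoticValues f).closure_eq]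
  refine Set.union_subset (fun c hc => ?_) Set.subset_union_right
  by_cases hcf : c ∈ toFun f '' singularLocus f
  · exact Or.inl hcf
  refine Or.inr ((mem_asymptoticValues_iff f c).2 fun r => ?_)
  have hsplit : toFun f '' singularLocus f ⊆
      toFun f '' (singularLocus f ∩ Metric.closedBall 0 r) ∪
        toFun f '' {z ∈ milnorSet f | r < ‖z‖} := by
    rintro _ ⟨z, hz, rfl⟩
    rcases le_or_gt ‖z‖ r with h | h
    · exact Or.inl ⟨z, ⟨hz, by simpa using h⟩, rfl⟩
    · exact Or.inr ⟨z, ⟨singularLocus_subset_milnorSet f hz, h⟩, rfl⟩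
  have hcomp : IsClosed (toFun f '' (singularLocus f ∩ Metric.closedBall 0 r)) :=
    (((isCompact_closedBall _ _).inter_left (isClosed_singularLocus f)).image
      (continuous_toFun f)).isClosed
  have := closure_mono hsplit hc
  rw [closure_union, hcomp.closure_eq] at this
  exact this.resolve_left fun h => hcf (Set.image_mono Set.inter_subset_left h)

/-- A first-order form with polynomial inequalities: the single parameter `t` forces both a large
norm and a small distance to `c`. -/
theorem mem_asymptoticValues_iff_forall_exists (f : MixedPolynomial n) (c : ℂ) :
    c ∈ asymptoticValues f ↔ ∀ t : ℝ, ∃ z ∈ milnorSet f,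
      t < ‖z‖ ^ 2 ∧ t * Complex.normSq (toFun f z - c) < 1 := by
  rw [mem_asymptoticValues_iff]
  constructor
  · intro h t
    obtain ⟨_, ⟨z, hz, rfl⟩, hd⟩ := Metric.mem_closure_iff.1 (h (|t| + 1)) (1 / (|t| + 1))
      (by positivity)
    refine ⟨z, hz.1, ?_, ?_⟩
    · nlinarith [hz.2, le_abs_self t, abs_nonneg t]
    · rw [Complex.normSq_eq_norm_sq]
      rw [dist_comm, dist_eq_norm, lt_div_iff₀ (by positivity)] at hd
      have h0 := norm_nonneg (toFun f z - c)
      have h1 : ‖toFun f z - c‖ ≤ 1 := by nlinarith [abs_nonneg t]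
      calc t * ‖toFun f z - c‖ ^ 2 ≤ |t| * ‖toFun f z - c‖ ^ 2 := by gcongr; exact le_abs_self t
        _ ≤ |t| * ‖toFun f z - c‖ := by gcongr; nlinarith
        _ ≤ ‖toFun f z - c‖ * (|t| + 1) := by nlinarith
        _ < 1 := hd
  · intro h r
    rw [Metric.mem_closure_iff]
    intro ε hε
    obtain ⟨z, hz, h1, h2⟩ := h (max (r ^ 2) (1 / ε ^ 2))
    refine ⟨_, ⟨z, ⟨hz, ?_⟩, rfl⟩, ?_⟩
    · exact lt_of_pow_lt_pow_left₀ 2 (norm_nonneg z) ((le_max_left _ _).trans_lt h1)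
    · rw [Complex.normSq_eq_norm_sq] at h2
      have h3 : 1 / ε ^ 2 * ‖toFun f z - c‖ ^ 2 < 1 :=
        (mul_le_mul_of_nonneg_right (le_max_right _ _) (sq_nonneg _)).trans_lt h2
      rw [one_div_mul_eq_div, div_lt_one (by positivity)] at h3
      rw [dist_comm, dist_eq_norm]
      exact lt_of_pow_lt_pow_left₀ 2 hε.le h3

/-! ### Real coordinates and semialgebraicity -/

/-- The point of `ℂⁿ` with given real and imaginary parts. -/
noncomputable def ofReIm (y : Fin n ⊕ Fin n → ℝ) : EuclideanSpace ℂ (Fin n) :=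
  WithLp.toLp 2 fun k => ⟨y (Sum.inl k), y (Sum.inr k)⟩

theorem surjective_ofReIm : Function.Surjective (ofReIm (n := n)) := fun z =>
  ⟨Sum.elim (fun k => (z k).re) (fun k => (z k).im), rfl⟩

theorem norm_sq_ofReIm (y : Fin n ⊕ Fin n → ℝ) :
    ‖ofReIm y‖ ^ 2 = ∑ k, (y (Sum.inl k) * y (Sum.inl k) + y (Sum.inr k) * y (Sum.inr k)) := by
  rw [EuclideanSpace.norm_sq_eq]
  refine Finset.sum_congr rfl fun k _ => ?_
  rw [← Complex.normSq_eq_norm_sq, Complex.normSq_apply]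
  rfl

variable {ι : Type*} {y : (ι → ℝ) → Fin n ⊕ Fin n → ℝ}

theorem isComplexPolyFun_ofReIm (hy : ∀ i, IsPolyFun fun x => y x i) (k : Fin n) :
    IsComplexPolyFun fun x => ofReIm (y x) k :=
  ⟨hy (Sum.inl k), hy (Sum.inr k)⟩

theorem isComplexPolyFun_toFun (hy : ∀ i, IsPolyFun fun x => y x i) (f : MixedPolynomial n) :
    IsComplexPolyFun fun x => toFun f (ofReIm (y x)) := by
  simp only [toFun_eq_eval_coordCLM]
  refine IsComplexPolyFun.eval (z := fun i x => coordCLM i (ofReIm (y x))) ?_ f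
  rintro (k | k)
  · exact isComplexPolyFun_ofReIm hy k
  · exact (isComplexPolyFun_ofReIm hy k).star

theorem signDetermined_image_singularLocus (f : MixedPolynomial n) :
    SignDetermined {x : Fin 2 → ℝ | (⟨x 0, x 1⟩ : ℂ) ∈ toFun f '' singularLocus f} := by
  have hset : {x : Fin 2 → ℝ | (⟨x 0, x 1⟩ : ℂ) ∈ toFun f '' singularLocus f} =
      -- The vector `w` packs the real and imaginary parts of `z` and then those of `μ`.
      {x | ∃ w : (Fin n ⊕ Fin n) ⊕ Fin 2 → ℝ,
        ¬ ((⟨w (Sum.inr 0), w (Sum.inr 1)⟩ : ℂ) = 0) ∧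
        (∀ k, (⟨w (Sum.inr 0), w (Sum.inr 1)⟩ : ℂ) * star (dz f k (ofReIm (w ∘ Sum.inl))) +
          star (⟨w (Sum.inr 0), w (Sum.inr 1)⟩ : ℂ) * dzbar f k (ofReIm (w ∘ Sum.inl)) = 0) ∧
        toFun f (ofReIm (w ∘ Sum.inl)) = ⟨x 0, x 1⟩} := by
    ext x
    constructor
    · rintro ⟨z, hz, hx⟩
      obtain ⟨y, rfl⟩ := surjective_ofReIm z
      obtain ⟨μ, hμ, h⟩ := (mem_singularLocus_iff f _).1 hz
      exact ⟨Sum.elim y ![μ.re, μ.im], hμ, h, hx⟩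
    · rintro ⟨w, hμ, h, hx⟩
      exact ⟨_, (mem_singularLocus_iff f _).2 ⟨_, hμ, h⟩, hx⟩
  rw [hset]
  refine SignDetermined.setOf_exists ?_
  have hy : ∀ i, IsPolyFun fun w : Fin 2 ⊕ ((Fin n ⊕ Fin n) ⊕ Fin 2) → ℝ =>
      ((w ∘ Sum.inr) ∘ Sum.inl) i := fun i => IsPolyFun.coord _
  have hμ : IsComplexPolyFun fun w : Fin 2 ⊕ ((Fin n ⊕ Fin n) ⊕ Fin 2) → ℝ =>
      (⟨(w ∘ Sum.inr) (Sum.inr 0), (w ∘ Sum.inr) (Sum.inr 1)⟩ : ℂ) :=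
    ⟨IsPolyFun.coord _, IsPolyFun.coord _⟩
  refine (hμ.signDetermined_eq (.const 0)).compl.inter (.inter (.iInter fun k => ?_) ?_)
  · exact ((hμ.mul (isComplexPolyFun_toFun hy _).star).add
      (hμ.star.mul (isComplexPolyFun_toFun hy _))).signDetermined_eq (.const 0)
  · exact (isComplexPolyFun_toFun hy f).signDetermined_eq
      ⟨IsPolyFun.coord (Sum.inl 0), IsPolyFun.coord (Sum.inl 1)⟩

theorem signDetermined_asymptoticValues (f : MixedPolynomial n) :
    SignDetermined {x : Fin 2 → ℝ | (⟨x 0, x 1⟩ : ℂ) ∈ asymptoticValues f} := by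
  have hset : {x : Fin 2 → ℝ | (⟨x 0, x 1⟩ : ℂ) ∈ asymptoticValues f} =
      -- As for the singular locus, with `λ` as the last entry of `w`.
      {x | ∀ t : Unit → ℝ, ∃ w : (Fin n ⊕ Fin n) ⊕ Fin 3 → ℝ,
        ¬ ((⟨w (Sum.inr 0), w (Sum.inr 1)⟩ : ℂ) = 0) ∧
        (∀ k, (w (Sum.inr 2) : ℂ) * ofReIm (w ∘ Sum.inl) k =
          (⟨w (Sum.inr 0), w (Sum.inr 1)⟩ : ℂ) * star (dz f k (ofReIm (w ∘ Sum.inl))) +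
          star (⟨w (Sum.inr 0), w (Sum.inr 1)⟩ : ℂ) * dzbar f k (ofReIm (w ∘ Sum.inl))) ∧
        t () < ∑ k, ((w ∘ Sum.inl) (Sum.inl k) * (w ∘ Sum.inl) (Sum.inl k) +
          (w ∘ Sum.inl) (Sum.inr k) * (w ∘ Sum.inl) (Sum.inr k)) ∧
        t () * (((toFun f (ofReIm (w ∘ Sum.inl))).re - x 0) *
          ((toFun f (ofReIm (w ∘ Sum.inl))).re - x 0) +
          ((toFun f (ofReIm (w ∘ Sum.inl))).im - x 1) *
          ((toFun f (ofReIm (w ∘ Sum.inl))).im - x 1)) < 1} := by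
    ext x
    simp only [Set.mem_ofPred_eq, mem_asymptoticValues_iff_forall_exists, ← norm_sq_ofReIm]
    constructor
    · intro h t
      obtain ⟨z, ⟨l, μ, hμ, h1⟩, h2, h3⟩ := h (t ())
      obtain ⟨y, rfl⟩ := surjective_ofReIm z
      exact ⟨Sum.elim y ![μ.re, μ.im, l], hμ, h1, h2, h3⟩
    · intro h t
      obtain ⟨w, hμ, h1, h2, h3⟩ := h fun _ => t
      exact ⟨_, ⟨_, _, hμ, h1⟩, h2, h3⟩
  rw [hset]
  refine SignDetermined.setOf_forall (SignDetermined.setOf_exists ?_)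
  have hy : ∀ i, IsPolyFun fun w : (Fin 2 ⊕ Unit) ⊕ ((Fin n ⊕ Fin n) ⊕ Fin 3) → ℝ =>
      ((w ∘ Sum.inr) ∘ Sum.inl) i := fun i => IsPolyFun.coord _
  have hμ : IsComplexPolyFun fun w : (Fin 2 ⊕ Unit) ⊕ ((Fin n ⊕ Fin n) ⊕ Fin 3) → ℝ =>
      (⟨(w ∘ Sum.inr) (Sum.inr 0), (w ∘ Sum.inr) (Sum.inr 1)⟩ : ℂ) :=
    ⟨IsPolyFun.coord _, IsPolyFun.coord _⟩
  have hf := isComplexPolyFun_toFun hy f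
  refine (hμ.signDetermined_eq (.const 0)).compl.inter (.inter (.iInter fun k => ?_) (.inter ?_ ?_))
  · exact ((IsComplexPolyFun.ofReal (.coord (Sum.inr (Sum.inr 2)))).mul
      (isComplexPolyFun_ofReIm hy k)).signDetermined_eq
        ((hμ.mul (isComplexPolyFun_toFun hy _).star).add
          (hμ.star.mul (isComplexPolyFun_toFun hy _)))
  · exact (IsPolyFun.coord (Sum.inl (Sum.inr ()))).signDetermined_lt
      (.sum _ fun k => ((hy _).mul (hy _)).add ((hy _).mul (hy _)))
  · have hre := hf.1.sub (.coord (Sum.inl (Sum.inl 0)))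
    have him := hf.2.sub (.coord (Sum.inl (Sum.inl 1)))
    exact ((IsPolyFun.coord (Sum.inl (Sum.inr ()))).mul
      ((hre.mul hre).add (him.mul him))).signDetermined_lt (.const 1)

end MixedPolynomial

theorem proposition2p3 {n : ℕ} (f : MixedPolynomial n) :
    (IsClosed (MixedPolynomial.asymptoticValues f) ∧
      IsSemialgebraicComplex (MixedPolynomial.asymptoticValues f)) ∧
    (IsClosed (MixedPolynomial.toFun f '' MixedPolynomial.singularLocus f ∪
        MixedPolynomial.asymptoticValues f) ∧
      IsSemialgebraicComplex (MixedPolynomial.toFun f '' MixedPolynomial.singularLocus f ∪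
        MixedPolynomial.asymptoticValues f)) :=
  have hS := (MixedPolynomial.signDetermined_asymptoticValues f).isSemialgebraic
  ⟨⟨MixedPolynomial.isClosed_asymptoticValues f, hS⟩,
    MixedPolynomial.isClosed_image_singularLocus_union f,
    (MixedPolynomial.signDetermined_image_singularLocus f).isSemialgebraic.union hS⟩
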